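/- Throughout, graphs are finite and simple. For a set $F$ of edges, $d_F(v)$ is the number of edges of $F$ incident to $v$, and $F$ is called Eulerian if $d_F(v)$ is even for every vertex $v$. Let $k$ be a positive integer and let $G=(A_1,A_2;E)$ be a bipartite graph with vertex classes $A_1,A_2$. A $(1,2k+1)$-bifactorization of $G$ is a pair $\mathbb F=(\mathcal F_1,\mathcal F_2)$ of families $\mathcal F_i=\{M_i,F_{i,1},\dots,F_{i,k}\}$ of subsets of $E$ such that, writing $E_i=M_i\cup F_{i,1}\cup\dots\cup F_{i,k}$ and $G_i$ for the graph formed by the edges $E_i$, the set $E$ is the disjoint union of $E_1$ and $E_2$ and, for $i=1,2$: the sets $M_i,F_{i,1},\dots,F_{i,k}$ are pairwise disjoint; $d_{M_i}(v)=\frac1{2k+1}d_{G_i}(v)$ for all $v\in A_i$; and each $F_{i,j}$ is Eulerian with $d_{F_{i,j}}(v)=\frac2{2k+1}d_{G_i}(v)$ for all $v\in A_i$. It is strong if $d_{E_i}(v)\ge(2k+1)(2k+2)$ for every $v\in A_i$ and $i=1,2$. A $(2k+1)$-path tracking decomposition of $G$ is a set $\mathcal B$ of vertex sequences $x_0x_1\cdots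 x_{2k+1}$, each of them a path in $G$ with $2k+1$ edges, such that every edge of $G$ lies in exactly one member of $\mathcal B$. For a vertex $v$ let $\mathcal B(v)$ be the number of members of $\mathcal B$ in which $v$ has odd degree plus twice the number of members that both start and end at $v$; for paths, this is just the number of members having $v$ as an end-vertex. The decomposition $\mathcal B$ is $\mathbb F$-balanced if $$\mathcal B(v)=\frac{d_{G_1}(v)}{2k+1}+d_{M_2}(v)\ \text{ for all } v\in A_1,\qquad \mathcal B(v)=\frac{d_{G_2}(v)}{2k+1}+d_{M_1}(v)\ \text{ for all } v\in A_2 .$$ **Theorem.** If $\mathbb F$ is a strong $(1,2k+1)$-bifactorization of the bipartite graph $G$, then $G$ admits an $\mathbb F$-balanced $(2k+1)$-path tracking decomposition. -/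

import Mathlib

namespace PathDecomp

variable {V : Type*}

/-- `d_F(v)`: the number of edges of the edge set `F` that are incident to `v`.
For a graph `G` one has `d_G(v) = edgeDegree G.edgeSet v`. -/
noncomputable def edgeDegree (F : Set (Sym2 V)) (v : V) : ℕ :=
  {e | e ∈ F ∧ v ∈ e}.ncard

/-- An edge set is Eulerian if every vertex has even degree in it
(no connectedness is required). -/
def IsEulerian (F : Set (Sym2 V)) : Prop :=
  ∀ v, Even (edgeDegree F v)

/-- `G = (A, B; E)`: the graph `G` is bipartite with vertex classes `A` and `B`. -/
def IsBipartition (G : SimpleGraph V) (A B : Set V) : Prop :=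
  G.IsBipartiteWith A B ∧ A ∪ B = Set.univ

/-! ### Factors and fractional factorizations -/

/-- `F` is an `(X, r, k)`-factor of `G`: a set of edges of `G` with
`d_F(v) = (r / k) d_G(v)` for every `v ∈ X`. -/
def IsFactor (G : SimpleGraph V) (X : Set V) (r k : ℕ) (F : Set (Sym2 V)) : Prop :=
  F ⊆ G.edgeSet ∧
    ∀ v ∈ X, (edgeDegree F v : ℚ) = (r : ℚ) / (k : ℚ) * (edgeDegree G.edgeSet v : ℚ)

/-- A family `{M_1, …, M_ℓ, F_1, …, F_m}` of edge sets. -/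
structure EdgeFamily (V : Type*) (ℓ m : ℕ) where
  M : Fin ℓ → Set (Sym2 V)
  F : Fin m → Set (Sym2 V)

/-- All members of the family, indexed together. -/
def EdgeFamily.parts {ℓ m : ℕ} (𝓕 : EdgeFamily V ℓ m) : Fin ℓ ⊕ Fin m → Set (Sym2 V) :=
  Sum.elim 𝓕.M 𝓕.F

/-- The union of all members of the family. -/
def EdgeFamily.edges {ℓ m : ℕ} (𝓕 : EdgeFamily V ℓ m) : Set (Sym2 V) :=
  ⋃ i, 𝓕.parts i

/-- `𝓕 = {M_1, …, M_ℓ, F_1, …, F_m}` is an `(X, ℓ, k)`-fractional factorization of `G`, where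
`k - ℓ = 2 m` is a positive even number. -/
structure IsFractionalFactorization {ℓ m : ℕ} (G : SimpleGraph V) (X : Set V) (k : ℕ)
    (𝓕 : EdgeFamily V ℓ m) : Prop where
  pos_left : 0 < ℓ
  pos_right : 0 < m
  eq_add : k = ℓ + 2 * m
  /-- the members partition the edge set of `G` -/
  pairwise_disjoint : Pairwise fun i j => Disjoint (𝓕.parts i) (𝓕.parts j)
  edges_eq : 𝓕.edges = G.edgeSet
  factor_M : ∀ i, IsFactor G X 1 k (𝓕.M i)
  factor_F : ∀ j, IsFactor G X 2 k (𝓕.F j)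
  eulerian_F : ∀ j, IsEulerian (𝓕.F j)

/-! ### Bifactorizations -/

/-- A pair `𝔽 = (𝓕₁, 𝓕₂)` of families of edge sets. -/
structure BiFamily (V : Type*) (ℓ m : ℕ) where
  fst : EdgeFamily V ℓ m
  snd : EdgeFamily V ℓ m

namespace BiFamily

variable {ℓ m : ℕ}

/-- `G₁`, the graph formed by the edges in the members of `𝓕₁`. -/
def G₁ (𝔽 : BiFamily V ℓ m) : SimpleGraph V := SimpleGraph.fromEdgeSet 𝔽.fst.edges

/-- `G₂`, the graph formed by the edges in the members of `𝓕₂`. -/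
def G₂ (𝔽 : BiFamily V ℓ m) : SimpleGraph V := SimpleGraph.fromEdgeSet 𝔽.snd.edges

end BiFamily

/-- `𝔽 = (𝓕₁, 𝓕₂)` is an `(ℓ, k)`-bifactorization of `G = (A₁, A₂; E)`. -/
structure IsBifactorization {ℓ m : ℕ} (G : SimpleGraph V) (A₁ A₂ : Set V) (k : ℕ)
    (𝔽 : BiFamily V ℓ m) : Prop where
  fst_subset : 𝔽.fst.edges ⊆ G.edgeSet
  snd_subset : 𝔽.snd.edges ⊆ G.edgeSet
  /-- `{G₁, G₂}` is a decomposition of `G` -/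
  union_eq : 𝔽.G₁.edgeSet ∪ 𝔽.G₂.edgeSet = G.edgeSet
  disjoint : Disjoint 𝔽.G₁.edgeSet 𝔽.G₂.edgeSet
  fst_fact : IsFractionalFactorization 𝔽.G₁ A₁ k 𝔽.fst
  snd_fact : IsFractionalFactorization 𝔽.G₂ A₂ k 𝔽.snd

/-- `p = 1` if `ℓ` is odd and `p = 2` if `ℓ` is even. -/
def parityParam (ℓ : ℕ) : ℕ := if Odd ℓ then 1 else 2

/-- The bifactorization `𝔽` is strong: with `p = 1` if `ℓ` is odd and `p = 2` if `ℓ` is even,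
`d_{E_i}(v) ≥ (k/p)((k/p) + p)` for every `v ∈ A_i`, where `E_i` is the union of `𝓕_i`. -/
structure IsStrongBifactorization {ℓ m : ℕ} (G : SimpleGraph V) (A₁ A₂ : Set V) (k : ℕ)
    (𝔽 : BiFamily V ℓ m) : Prop extends IsBifactorization G A₁ A₂ k 𝔽 where
  fst_strong : ∀ v ∈ A₁, ((k : ℚ) / parityParam ℓ) * ((k : ℚ) / parityParam ℓ + parityParam ℓ) ≤
    (edgeDegree 𝔽.fst.edges v : ℚ)
  snd_strong : ∀ v ∈ A₂, ((k : ℚ) / parityParam ℓ) * ((k : ℚ) / parityParam ℓ + parityParam ℓ) ≤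
    (edgeDegree 𝔽.snd.edges v : ℚ)

/-! ### Trackings and tracking decompositions -/

/-- A sequence `x_0 x_1 ⋯ x_ℓ` of vertices, consecutive ones being adjacent in `G`. -/
structure Tracking (G : SimpleGraph V) where
  start : V
  finish : V
  walk : G.Walk start finish

namespace Tracking

variable {G : SimpleGraph V}

/-- `E(B)`, the set of edges traversed by `B`. -/
def edgeSet (B : Tracking G) : Set (Sym2 V) := {e | e ∈ B.walk.edges}

/-- `B = x_0 x_1 ⋯ x_ℓ` tracks a vanilla `ℓ`-trail: it has `ℓ` edges, which are pairwise
distinct, and its interior `x_1 ⋯ x_{ℓ-1}` is a path. -/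
def IsVanilla (B : Tracking G) (ℓ : ℕ) : Prop :=
  B.walk.length = ℓ ∧ B.walk.IsTrail ∧ B.walk.tail.dropLast.IsPath

end Tracking

/-- `𝓑` is an `ℓ`-tracking decomposition of `G`: a set of pairwise edge-disjoint trackings of
vanilla `ℓ`-trails that together cover all edges of `G`. -/
structure IsTrackingDecomposition {G : SimpleGraph V} (ℓ : ℕ) (𝓑 : Set (Tracking G)) : Prop where
  vanilla : ∀ B ∈ 𝓑, B.IsVanilla ℓ
  edge_disjoint : 𝓑.Pairwise fun B B' => Disjoint B.edgeSet B'.edgeSet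
  covers : (⋃ B ∈ 𝓑, B.edgeSet) = G.edgeSet

/-- `𝓑` is an `ℓ`-path tracking decomposition: all of its members induce paths (of length `ℓ`). -/
structure IsPathTrackingDecomposition {G : SimpleGraph V} (ℓ : ℕ) (𝓑 : Set (Tracking G)) : Prop
    extends IsTrackingDecomposition ℓ 𝓑 where
  isPath : ∀ B ∈ 𝓑, B.walk.IsPath

/-- `𝓑_odd(v)`: the number of members of `𝓑` in whose trail `v` has odd degree. -/
noncomputable def oddCount {G : SimpleGraph V} (𝓑 : Set (Tracking G)) (v : V) : ℕ :=
  {B | B ∈ 𝓑 ∧ Odd (edgeDegree B.edgeSet v)}.ncard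

/-- `𝓑_even(v)`: the number of members of `𝓑` that both start and end at `v`. -/
noncomputable def evenCount {G : SimpleGraph V} (𝓑 : Set (Tracking G)) (v : V) : ℕ :=
  {B | B ∈ 𝓑 ∧ B.start = v ∧ B.finish = v}.ncard

/-- `𝓑(v) = 𝓑_odd(v) + 2 𝓑_even(v)`. -/
noncomputable def endCount {G : SimpleGraph V} (𝓑 : Set (Tracking G)) (v : V) : ℕ :=
  oddCount 𝓑 v + 2 * evenCount 𝓑 v

/-- The `(2k+1)`-tracking decomposition `𝓑` of `G = (A, B; E)` is `𝔽`-balanced, where `𝔽` is a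
`(1, 2k+1)`-bifactorization of `G`; here `𝔽.fst.M 0` and `𝔽.snd.M 0` are the only `M`-members
`M₁` and `M₂` of its two families. -/
structure IsBalanced {G : SimpleGraph V} {k : ℕ} (A B : Set V) (𝔽 : BiFamily V 1 k)
    (𝓑 : Set (Tracking G)) : Prop where
  left : ∀ v ∈ A, (endCount 𝓑 v : ℚ) =
    (edgeDegree 𝔽.G₁.edgeSet v : ℚ) / (2 * (k : ℚ) + 1) + (edgeDegree (𝔽.snd.M 0) v : ℚ)
  right : ∀ v ∈ B, (endCount 𝓑 v : ℚ) =
    (edgeDegree 𝔽.G₂.edgeSet v : ℚ) / (2 * (k : ℚ) + 1) + (edgeDegree (𝔽.fst.M 0) v : ℚ)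

end PathDecomp

/-!
The bifactorization is first turned into a sequence of layers. Each Eulerian member `F_{i,j}` splits
into two halves of equal degree at every vertex (`IsEulerian.exists_half`), so that the family
`𝓕_i` becomes a sequence `M_i, F', F'', …` of `2k + 1` layers of the same degree `d_{G_i}(v)/(2k+1)`
at each `v ∈ A_i`, while at the other vertices the two halves of one `F_{i,j}` balance
(`IsFractionalFactorization.exists_layers`). Superpose the layers of `𝓕₁` in this order and those of
`𝓕₂` in reversed order to `L 0, …, L (2k)`. Then a vertex of the class reached after `r + 1` steps
from `A₂` has equal degrees in `L r` and `L (r + 1)`, and by strength at least `2k + 2`. Pairing the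
edges of consecutive layers at each vertex gives trails of length `2k + 1` with the required numbers
of ends. The content of the theorem is that the pairing can be chosen to give paths.

The paths are grown layer by layer (`exists_pathFamily`). When each path has received its next edge,
its new last vertex, the leaf, may already lie on it; call such a trail bad. First, leaves
are exchanged among bad trails hanging at the same vertex, until at most `k` of the at least
`2k + 2` trails hanging there are bad (`IsTrunkFamily.exists_few_bad`). The remaining bad trails
are removed one at a time. Suppose that the leaf `u` of `T` also is its `j`-th vertex. Reversing the
closed part of `T`, the last edge of `T` becomes the edge `xu` from its `(j+1)`-st vertex `x`. More
than `k` good trails hang at `x`, and at most `k` vertices of `T` are in the class of `u`, so some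
good trail `T'` hanging at `x` has its leaf off `T`; exchange the leaves of `T` and `T'`. Now `T` is
a path, and either `T'` remains a path, or `T'` contains `u` and takes over the part of `T`. This
walk never returns to a trail, because the edge joining `u` to the vertex at which a visited trail
hangs is always on a visited trail or is the last edge of the current one
(`IsTrunkFamily.exists_fewer_bad_of_walk`). So the number of bad trails goes down. No step lowers the
number of good trails hanging at any vertex, so that the argument can be repeated.
-/

namespace PathDecomp

open Finset

/-! ### Families of trails indexed by position -/

/-- The edge at position `r` of the vertex sequence `x`. -/
def stepEdge {V : Type*} (x : ℕ → V) (r : ℕ) : Sym2 V := s(x r, x (r + 1))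

/-- The sequences `y t 0, …, y t n` run through the edges of `E`, each edge being used at exactly
one position of exactly one sequence. The map `χ` takes the values `0` and `1` on the two classes
of a bipartition, and position `r` lies in the class `r % 2`. The values `y t r` with `n < r` are
irrelevant. -/
structure IsTrailFamily {V ι : Type*} (χ : V → ℕ) (n : ℕ) (E : Set (Sym2 V))
    (y : ι → ℕ → V) : Prop where
  color : ∀ t r, r ≤ n → χ (y t r) = r % 2
  inj : ∀ t r t' r', r < n → r' < n → stepEdge (y t) r = stepEdge (y t') r' → t = t' ∧ r = r'
  mem_iff : ∀ e, e ∈ E ↔ ∃ t r, r < n ∧ stepEdge (y t) r = e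

/-- A trail family all of whose trails become paths of length `i` when the last edge is dropped.
The first `i + 1` vertices of a trail form its trunk, the vertex at position `i + 1` is its leaf,
and the trail is said to hang at its vertex at position `i`. -/
structure IsTrunkFamily {V ι : Type*} (χ : V → ℕ) (i : ℕ) (E : Set (Sym2 V))
    (y : ι → ℕ → V) : Prop extends IsTrailFamily χ (i + 1) E y where
  trunk_inj : ∀ t r r', r ≤ i → r' ≤ i → y t r = y t r' → r = r'

/-- The leaf of the trail `x` lies on its trunk. -/
def IsBad {V : Type*} (i : ℕ) (x : ℕ → V) : Prop := ∃ r ≤ i, x r = x (i + 1)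

section Moves

variable {V ι : Type*} {χ : V → ℕ} {i n : ℕ} {E : Set (Sym2 V)} {y : ι → ℕ → V}

/-- Moving the edges of a trail family to other positions along an involution `σ` of the set of
positions gives a trail family with the same edges. -/
theorem IsTrailFamily.of_involution (h : IsTrailFamily χ n E y) {z : ι → ℕ → V}
    (σ : ι → ℕ → ι × ℕ) (hlt : ∀ t r, r < n → (σ t r).2 < n)
    (hσ : ∀ t r, r < n → σ (σ t r).1 (σ t r).2 = (t, r))
    (hcolor : ∀ t r, r ≤ n → χ (z t r) = r % 2)
    (hedge : ∀ t r, r < n → stepEdge (z t) r = stepEdge (y (σ t r).1) (σ t r).2) :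
    IsTrailFamily χ n E z where
  color := hcolor
  inj t r t' r' hr hr' he := by
    rw [hedge t r hr, hedge t' r' hr'] at he
    obtain ⟨h₁, h₂⟩ := h.inj _ _ _ _ (hlt t r hr) (hlt t' r' hr') he
    have := hσ t r hr
    rw [h₁, h₂, hσ t' r' hr'] at this
    simp_all
  mem_iff e := by
    rw [h.mem_iff]
    constructor
    · rintro ⟨t, r, hr, rfl⟩
      refine ⟨(σ t r).1, (σ t r).2, hlt t r hr, ?_⟩
      rw [hedge _ _ (hlt t r hr), hσ t r hr]
    · rintro ⟨t, r, hr, rfl⟩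
      exact ⟨_, _, hlt t r hr, (hedge t r hr).symm⟩

open Classical in
/-- If the leaf of the trail `y c` is its own vertex at position `j`, then the positions
`j, …, i + 1` form a closed walk; traverse it in the opposite direction. -/
noncomputable def reverseLoop (y : ι → ℕ → V) (i j : ℕ) (c : ι) : ι → ℕ → V :=
  fun t r => if t = c ∧ j < r ∧ r ≤ i then y t (i + 1 + j - r) else y t r

open Classical in
/-- Exchange the leaves of the trails `c` and `d`. -/
noncomputable def swapLeaf (y : ι → ℕ → V) (i : ℕ) (c d : ι) : ι → ℕ → V :=
  fun t r => if r = i + 1 then y (Equiv.swap c d t) r else y t r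

theorem reverseLoop_of_ne {j : ℕ} {c t : ι} (h : t ≠ c) : reverseLoop y i j c t = y t := by
  funext r; simp [reverseLoop, h]

theorem reverseLoop_of_le {j : ℕ} {c t : ι} {r : ℕ} (h : r ≤ j) :
    reverseLoop y i j c t r = y t r := by
  simp [reverseLoop, h.not_gt]

theorem reverseLoop_of_lt {j : ℕ} {c : ι} {r : ℕ} (h : j < r) (h' : r ≤ i) :
    reverseLoop y i j c c r = y c (i + 1 + j - r) := by
  simp [reverseLoop, h, h']

theorem reverseLoop_leaf {j : ℕ} {c t : ι} :
    reverseLoop y i j c t (i + 1) = y t (i + 1) := by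
  simp [reverseLoop]

theorem exists_reverseLoop_eq {j : ℕ} {c t : ι} {r : ℕ} (hr : r ≤ i) :
    ∃ r' ≤ i, reverseLoop y i j c t r = y t r' := by
  by_cases h : t = c ∧ j < r ∧ r ≤ i
  · refine ⟨i + 1 + j - r, by lia, by simp only [reverseLoop, h, if_true, and_self]⟩
  · exact ⟨r, hr, by simp only [reverseLoop, h, if_false]⟩

theorem swapLeaf_of_le {c d t : ι} {r : ℕ} (h : r ≤ i) : swapLeaf y i c d t r = y t r := by
  simp [swapLeaf, show r ≠ i + 1 by lia]

theorem swapLeaf_left {c d : ι} : swapLeaf y i c d c (i + 1) = y d (i + 1) := by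
  simp [swapLeaf]

theorem swapLeaf_right {c d : ι} : swapLeaf y i c d d (i + 1) = y c (i + 1) := by
  simp [swapLeaf]

theorem swapLeaf_of_ne {c d t : ι} (hc : t ≠ c) (hd : t ≠ d) : swapLeaf y i c d t = y t := by
  classical
  funext r
  simp [swapLeaf, Equiv.swap_apply_of_ne_of_ne hc hd]

theorem card_swapLeaf_leaf [Fintype ι] [DecidableEq V] (c d : ι) (v : V) :
    #{t | swapLeaf y i c d t (i + 1) = v} = #{t | y t (i + 1) = v} := by
  classical
  refine Finset.card_equiv (Equiv.swap c d) fun t => ?_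
  simp [swapLeaf]

theorem IsTrunkFamily.reverseLoop (h : IsTrunkFamily χ i E y) {j : ℕ} {c : ι} (hj : j ≤ i)
    (hu : y c j = y c (i + 1)) : IsTrunkFamily χ i E (reverseLoop y i j c) := by
  classical
  have hpar : j % 2 = (i + 1) % 2 := by
    rw [← h.color c j (by lia), ← h.color c (i + 1) le_rfl, hu]
  have hji : j < i := by lia
  refine ⟨h.toIsTrailFamily.of_involution
    (fun t r => if t = c ∧ j ≤ r then (t, i + j - r) else (t, r)) ?_ ?_ ?_ ?_, ?_⟩
  · intro t r hr; split_ifs <;> simp only <;> lia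
  · intro t r hr
    by_cases h' : t = c ∧ j ≤ r
    · have : j ≤ i + j - r := by lia
      simp only [h', and_self, if_true, this, Prod.mk.injEq, true_and]
      lia
    · simp [h']
  · intro t r hr
    by_cases h' : t = c ∧ j < r ∧ r ≤ i
    · obtain ⟨rfl, h₁, h₂⟩ := h'
      rw [reverseLoop_of_lt h₁ h₂, h.color _ _ (by lia)]
      lia
    · simp only [PathDecomp.reverseLoop, h', if_false]
      exact h.color t r hr
  · intro t r hr
    by_cases htc : t = c
    swap
    · simp [reverseLoop_of_ne htc, htc]
    subst htc
    by_cases hjr : j ≤ r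
    swap
    · simp [stepEdge, hjr, reverseLoop_of_le (show r ≤ j by lia),
        reverseLoop_of_le (show r + 1 ≤ j by lia)]
    have e₁ : PathDecomp.reverseLoop y i j t t r = y t (i + j - r + 1) := by
      rcases hjr.eq_or_lt with rfl | hlt
      · rw [reverseLoop_of_le le_rfl, hu]; congr 1; lia
      · rw [reverseLoop_of_lt hlt (by lia)]; congr 1; lia
    have e₂ : PathDecomp.reverseLoop y i j t t (r + 1) = y t (i + j - r) := by
      rcases (show r ≤ i by lia).eq_or_lt with rfl | hlt
      · rw [reverseLoop_leaf, ← hu]; congr 1; lia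
      · rw [reverseLoop_of_lt (by lia) (by lia)]; congr 1; lia
    simp only [stepEdge, e₁, e₂, hjr, and_self, if_true]
    exact Sym2.eq_swap
  · intro t r r' hr hr' he
    by_cases htc : t = c
    swap
    · rw [reverseLoop_of_ne htc] at he
      exact h.trunk_inj t r r' hr hr' he
    subst htc
    rcases le_or_gt r j with h₁ | h₁ <;> rcases le_or_gt r' j with h₂ | h₂
    · rw [reverseLoop_of_le h₁, reverseLoop_of_le h₂] at he
      exact h.trunk_inj t r r' hr hr' he
    · rw [reverseLoop_of_le h₁, reverseLoop_of_lt h₂ hr'] at he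
      have := h.trunk_inj t _ _ hr (by lia) he
      lia
    · rw [reverseLoop_of_lt h₁ hr, reverseLoop_of_le h₂] at he
      have := h.trunk_inj t _ _ (by lia) hr' he
      lia
    · rw [reverseLoop_of_lt h₁ hr, reverseLoop_of_lt h₂ hr'] at he
      have := h.trunk_inj t _ _ (by lia) (by lia) he
      lia

theorem IsTrunkFamily.swapLeaf (h : IsTrunkFamily χ i E y) {c d : ι} (hcd : y c i = y d i) :
    IsTrunkFamily χ i E (swapLeaf y i c d) := by
  classical
  have hi : ∀ t, y (Equiv.swap c d t) i = y t i := by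
    intro t
    by_cases h₁ : t = c
    · subst h₁; simp [hcd]
    by_cases h₂ : t = d
    · subst h₂; simp [hcd]
    rw [Equiv.swap_apply_of_ne_of_ne h₁ h₂]
  refine ⟨h.toIsTrailFamily.of_involution
    (fun t r => if r = i then (Equiv.swap c d t, r) else (t, r)) ?_ ?_ ?_ ?_, ?_⟩
  · intro t r hr; split_ifs <;> exact hr
  · intro t r hr
    by_cases h' : r = i <;> simp [h']
  · intro t r hr
    simp only [PathDecomp.swapLeaf]
    split_ifs <;> exact h.color _ r hr
  · intro t r hr
    by_cases h' : r = i
    · subst h'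
      simp [stepEdge, PathDecomp.swapLeaf, hi]
    · simp [stepEdge, PathDecomp.swapLeaf, h', show r ≠ i + 1 by lia]
  · intro t r r' hr hr' he
    rw [swapLeaf_of_le hr, swapLeaf_of_le hr'] at he
    exact h.trunk_inj t r r' hr hr' he

theorem card_filter_mod_two_le {i k : ℕ} (hi : i ≤ 2 * k) :
    #{r ∈ range (i + 1) | r % 2 = (i + 1) % 2} ≤ k := by
  conv_rhs => rw [← card_range k]
  refine card_le_card_of_injOn (· / 2) ?_ ?_
  · intro r hr
    simp only [coe_filter, mem_range, Set.mem_ofPred_eq] at hr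
    simp only [coe_range, Set.mem_Iio]
    lia
  · intro r hr r' hr' he
    simp only [coe_filter, mem_range, Set.mem_ofPred_eq] at hr hr' he
    lia

/-- Among more than `k` trails hanging at the same vertex, one has its leaf off the trunk of a
given trail: the leaves are distinct, and by bipartiteness only `k` trunk vertices of that trail
are in the class of the leaves. -/
theorem IsTrunkFamily.exists_leaf_off_trunk (h : IsTrunkFamily χ i E y) {k : ℕ} (hi : i ≤ 2 * k)
    (c : ι) (x : V) (H : Finset ι) (hH : ∀ t ∈ H, y t i = x) (hk : k < #H) :
    ∃ t ∈ H, ∀ r ≤ i, y c r ≠ y t (i + 1) := by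
  classical
  by_contra! hcon
  have h₁ : Set.InjOn (fun t => y t (i + 1)) H := by
    intro t ht t' ht' he
    refine (h.inj t i t' i (by lia) (by lia) ?_).1
    simp only at he
    rw [stepEdge, stepEdge, he, hH t ht, hH t' ht']
  have h₂ : H.image (fun t => y t (i + 1)) ⊆
      ({r ∈ range (i + 1) | r % 2 = (i + 1) % 2}).image (y c) := by
    intro v hv
    obtain ⟨t, ht, rfl⟩ := mem_image.mp hv
    obtain ⟨r, hr, he⟩ := hcon t ht
    refine mem_image.mpr ⟨r, ?_, he⟩
    rw [mem_filter, mem_range]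
    refine ⟨by lia, ?_⟩
    rw [← h.color c r (by lia), he, h.color t _ le_rfl]
  have h₃ := card_le_card h₂
  rw [card_image_of_injOn h₁] at h₃
  have := h₃.trans (card_image_le.trans (card_filter_mod_two_le hi))
  lia

end Moves

/-! ### Disentangling the leaves -/

section Disentangle

variable {V ι : Type*} [Fintype ι] {χ : V → ℕ} {i k : ℕ} {E : Set (Sym2 V)} {y : ι → ℕ → V}

open Classical in
/-- The trails with leaf on the trunk. -/
noncomputable def badTrails (i : ℕ) (y : ι → ℕ → V) : Finset ι := {t | IsBad i (y t)}

open Classical in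
/-- The trails hanging at `p` with leaf off the trunk. -/
noncomputable def goodTrailsAt (i : ℕ) (y : ι → ℕ → V) (p : V) : Finset ι :=
  {t | ¬ IsBad i (y t) ∧ y t i = p}

theorem mem_badTrails {t : ι} : t ∈ badTrails i y ↔ IsBad i (y t) := by simp [badTrails]

theorem mem_goodTrailsAt {t : ι} {p : V} :
    t ∈ goodTrailsAt i y p ↔ ¬ IsBad i (y t) ∧ y t i = p := by simp [goodTrailsAt]

open Classical in
/-- The two families have the same initial vertices and, with multiplicity, the same leaves. -/
def SameEnds (i : ℕ) (y z : ι → ℕ → V) : Prop :=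
  (∀ t, z t 0 = y t 0) ∧ ∀ v, #{t | z t (i + 1) = v} = #{t | y t (i + 1) = v}

theorem SameEnds.refl : SameEnds i y y := ⟨fun _ => rfl, fun _ => rfl⟩

theorem SameEnds.trans {z w : ι → ℕ → V} (h : SameEnds i y z) (h' : SameEnds i z w) :
    SameEnds i y w :=
  ⟨fun t => (h'.1 t).trans (h.1 t), fun v => (h'.2 v).trans (h.2 v)⟩

/-- Exchanging leaves among bad trails that hang at the same vertex, at most `k` bad trails are
left at each vertex. -/
theorem IsTrunkFamily.exists_few_bad (hi : i ≤ 2 * k) {y : ι → ℕ → V}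
    (h : IsTrunkFamily χ i E y) :
    ∃ z, IsTrunkFamily χ i E z ∧ SameEnds i y z ∧ (∀ t, z t i = y t i) ∧
      ∀ p, ∀ H ⊆ badTrails i z, (∀ t ∈ H, z t i = p) → #H ≤ k := by
  induction hb : #(badTrails i y) using Nat.strong_induction_on generalizing y with
  | _ b ih =>
  by_cases hdone : ∀ p, ∀ H ⊆ badTrails i y, (∀ t ∈ H, y t i = p) → #H ≤ k
  · exact ⟨y, h, .refl, fun _ => rfl, hdone⟩
  push Not at hdone
  obtain ⟨p, H, hHb, hHp, hHk⟩ := hdone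
  obtain ⟨c, hc⟩ : H.Nonempty := card_pos.mp (by lia)
  obtain ⟨d, hd, hdc⟩ := h.exists_leaf_off_trunk hi c p H hHp hHk
  have hz := h.swapLeaf (show y c i = y d i by rw [hHp c hc, hHp d hd])
  have hlt : badTrails i (PathDecomp.swapLeaf y i c d) ⊂ badTrails i y := by
    rw [ssubset_iff_of_subset]
    · refine ⟨c, hHb hc, ?_⟩
      rw [mem_badTrails]
      rintro ⟨r, hr, he⟩
      rw [swapLeaf_of_le hr, swapLeaf_left] at he
      exact hdc r hr he
    · intro t ht
      by_cases htc : t = c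
      · exact htc ▸ hHb hc
      by_cases htd : t = d
      · exact htd ▸ hHb hd
      rwa [mem_badTrails, swapLeaf_of_ne htc htd, ← mem_badTrails] at ht
  obtain ⟨w, hw, hends, hwi, hwk⟩ := ih _ (hb ▸ card_lt_card hlt) hz rfl
  refine ⟨w, hw, .trans ⟨fun t => swapLeaf_of_le (Nat.zero_le i), ?_⟩ hends, ?_, hwk⟩
  · classical
    intro v
    convert card_swapLeaf_leaf (y := y) (i := i) c d v
  · intro t
    rw [hwi, swapLeaf_of_le le_rfl]

/-- One step of the walk: the loop of the bad trail `c`, whose leaf `u` is its vertex at position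
`j`, is reversed, and then its leaf is exchanged with that of a trail `d` hanging at the same
vertex. Afterwards `c` is good, and `d` has the leaf `u`. -/
theorem IsTrunkFamily.exists_step (hi : i ≤ 2 * k) (h : IsTrunkFamily χ i E y)
    (hgood : ∀ p, χ p = i % 2 → k < #(goodTrailsAt i y p)) {c : ι} {j : ℕ} (hj : j < i)
    (hu : y c j = y c (i + 1)) :
    ∃ d z, d ≠ c ∧ y d i = y c (j + 1) ∧ ¬ IsBad i (y d) ∧ IsTrunkFamily χ i E z ∧
      SameEnds i y z ∧ (∀ t, t ≠ c → t ≠ d → z t = y t) ∧ (∀ r ≤ i, z d r = y d r) ∧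
      z d (i + 1) = y c (i + 1) ∧ ¬ IsBad i (z c) ∧ z c i = y c (j + 1) ∧
      z c j = y c (i + 1) ∧ z c (j + 1) = y c i := by
  have hpar : j % 2 = (i + 1) % 2 := by
    rw [← h.color c j (by lia), ← h.color c (i + 1) le_rfl, hu]
  obtain ⟨d, hd, hdc⟩ := h.exists_leaf_off_trunk hi c (y c (j + 1))
    (goodTrailsAt i y (y c (j + 1))) (fun t ht => (mem_goodTrailsAt.mp ht).2)
    (hgood _ (by rw [h.color _ _ (by lia)]; lia))
  rw [mem_goodTrailsAt] at hd
  have hne : d ≠ c := by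
    rintro rfl
    exact hd.1 ⟨j, hj.le, hu⟩
  have hci : PathDecomp.reverseLoop y i j c c i = y c (j + 1) := by
    rw [reverseLoop_of_lt hj le_rfl]
    congr 1
    lia
  have hz := (h.reverseLoop hj.le hu).swapLeaf (c := c) (d := d)
    (by rw [hci, reverseLoop_of_ne hne, hd.2])
  refine ⟨d, _, hne, hd.2, hd.1, hz, ⟨?_, ?_⟩, ?_, ?_, ?_, ?_, ?_, ?_, ?_⟩
  · intro t
    rw [swapLeaf_of_le (Nat.zero_le i), reverseLoop_of_le (Nat.zero_le j)]
  · classical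
    intro v
    convert card_swapLeaf_leaf (y := PathDecomp.reverseLoop y i j c) (i := i) c d v using 2
    simp only [reverseLoop_leaf]
  · intro t htc htd
    rw [swapLeaf_of_ne htc htd, reverseLoop_of_ne htc]
  · intro r hr
    rw [swapLeaf_of_le hr, reverseLoop_of_ne hne]
  · rw [swapLeaf_right, reverseLoop_leaf]
  · rintro ⟨r, hr, he⟩
    rw [swapLeaf_left, swapLeaf_of_le hr, reverseLoop_leaf] at he
    obtain ⟨r', hr', he'⟩ := exists_reverseLoop_eq (y := y) (j := j) (c := c) (t := c) hr
    exact hdc r' hr' (he'.symm.trans he)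
  · rw [swapLeaf_of_le le_rfl, hci]
  · rw [swapLeaf_of_le hj.le, reverseLoop_of_le le_rfl, hu]
  · rw [swapLeaf_of_le (by lia), reverseLoop_of_lt (by lia) (by lia)]
    congr 1
    lia

/-- The walk that gets rid of a bad leaf. The trail `c` is the one with the bad leaf `u`, and `W`
is the set of the trails visited before it. Every visited trail `t` hangs at a vertex that is
joined to `u` by an edge on the trunk of a visited trail, or by the last edge of `c`. Hence the
next trail, which hangs at a vertex joined to `u` by an edge on the trunk of `c`, is a new one, and
the walk ends. -/
theorem IsTrunkFamily.exists_fewer_bad_of_walk (hi : i ≤ 2 * k) (u : V) {y : ι → ℕ → V}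
    (h : IsTrunkFamily χ i E y) (hgood : ∀ p, χ p = i % 2 → k < #(goodTrailsAt i y p))
    (W : Finset ι) {c : ι} (hcW : c ∉ W) (hc : IsBad i (y c)) (hu : y c (i + 1) = u)
    (hW : ∀ t ∈ W, (∃ t' ∈ W, ∃ r < i, stepEdge (y t') r = s(y t i, u)) ∨
      stepEdge (y c) i = s(y t i, u)) :
    ∃ z, IsTrunkFamily χ i E z ∧ SameEnds i y z ∧ #(badTrails i z) < #(badTrails i y) ∧
      ∀ p, #(goodTrailsAt i y p) ≤ #(goodTrailsAt i z p) := by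
  classical
  induction hn : #(univ \ W) using Nat.strong_induction_on generalizing y W c with
  | _ n ih =>
  obtain ⟨j, hji, hj⟩ := id hc
  have hji : j < i := by
    have hpar : j % 2 = (i + 1) % 2 := by
      rw [← h.color c j (by lia), ← h.color c (i + 1) le_rfl, hj]
    lia
  obtain ⟨d, z, hdc, hdx, hdgood, hz, hends, hzne, hzd, hzdleaf, hzc, hzci, hzcj, hzcj'⟩ :=
    h.exists_step hi hgood hji hj
  have hdW : d ∉ W := by
    intro hd
    have hx : stepEdge (y c) j = s(y d i, u) := by
      rw [stepEdge, hj, hu, hdx]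
      exact Sym2.eq_swap
    rcases hW d hd with ⟨t', ht', r, hr, he⟩ | he
    · obtain ⟨rfl, -⟩ := h.inj _ _ _ _ (by lia) (by lia) (he.trans hx.symm)
      exact hcW ht'
    · have := (h.inj _ _ _ _ (by lia) (by lia) (he.trans hx.symm)).2
      lia
  have hgood' : ∀ p, #(goodTrailsAt i y p) ≤ #(goodTrailsAt i z p) := by
    intro p
    -- the good trail `d` is replaced by `c`, which was bad and now hangs at the same vertex
    refine card_le_card_of_injOn (fun t => if t = d then c else t) ?_ ?_
    · intro t ht
      have ht := mem_goodTrailsAt.mp ht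
      rw [mem_coe, mem_goodTrailsAt]
      dsimp only
      by_cases htd : t = d
      · subst htd
        rw [if_pos rfl, hzci, ← hdx]
        exact ⟨hzc, ht.2⟩
      · have htc : t ≠ c := by rintro rfl; exact ht.1 hc
        rwa [if_neg htd, hzne t htc htd]
    · intro t ht t' ht' he
      have htc : t ≠ c := by rintro rfl; exact (mem_goodTrailsAt.mp ht).1 hc
      have htc' : t' ≠ c := by rintro rfl; exact (mem_goodTrailsAt.mp ht').1 hc
      dsimp only at he
      split_ifs at he <;> simp_all
  by_cases hbad : IsBad i (z d)
  swap
  · refine ⟨z, hz, hends, card_lt_card ?_, hgood'⟩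
    rw [ssubset_iff_of_subset]
    · exact ⟨c, mem_badTrails.mpr hc, fun h' => hzc (mem_badTrails.mp h')⟩
    · intro t ht
      rw [mem_badTrails] at ht ⊢
      have htc : t ≠ c := by rintro rfl; exact hzc ht
      have htd : t ≠ d := by rintro rfl; exact hbad ht
      rwa [hzne t htc htd] at ht
  have hcard : #(badTrails i z) ≤ #(badTrails i y) := by
    refine (card_le_card (t := insert d ((badTrails i y).erase c)) ?_).trans ?_
    · intro t ht
      rw [mem_insert, mem_erase, mem_badTrails]
      rw [mem_badTrails] at ht
      have htc : t ≠ c := by rintro rfl; exact hzc ht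
      by_cases htd : t = d
      · exact Or.inl htd
      · rw [hzne t htc htd] at ht
        exact Or.inr ⟨htc, ht⟩
    · exact (card_insert_le _ _).trans (card_erase_add_one (mem_badTrails.mpr hc)).le
  have hW' : ∀ t ∈ insert c W, (∃ t' ∈ insert c W, ∃ r < i, stepEdge (z t') r = s(z t i, u)) ∨
      stepEdge (z d) i = s(z t i, u) := by
    intro t ht
    rcases mem_insert.mp ht with rfl | htW
    · right
      rw [stepEdge, hzd i le_rfl, hzdleaf, hu, hzci, hdx]
    · have htc : t ≠ c := by rintro rfl; exact hcW htW
      have htd : t ≠ d := by rintro rfl; exact hdW htW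
      left
      rw [hzne t htc htd]
      rcases hW t htW with ⟨t', ht', r, hr, he⟩ | he
      · refine ⟨t', mem_insert_of_mem ht', r, hr, ?_⟩
        rwa [hzne t' (by rintro rfl; exact hcW ht') (by rintro rfl; exact hdW ht')]
      · refine ⟨c, mem_insert_self c W, j, hji, ?_⟩
        rw [← he, stepEdge, hzcj, hzcj', stepEdge]
        exact Sym2.eq_swap
  obtain ⟨w, hw, hends', hlt, hge⟩ := ih #(univ \ insert c W)
    (hn ▸ card_lt_card (by
      rw [ssubset_iff_of_subset (sdiff_subset_sdiff le_rfl (subset_insert c W))]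
      exact ⟨c, by simpa using hcW, by simp⟩))
    hz (fun p hp => (hgood p hp).trans_le (hgood' p)) (insert c W)
    (by simp [hdc, hdW]) hbad (hzdleaf.trans hu) hW' rfl
  exact ⟨w, hw, hends.trans hends', hlt.trans_le hcard, fun p => (hgood' p).trans (hge p)⟩

theorem IsTrunkFamily.exists_no_bad_of_good (hi : i ≤ 2 * k) {y : ι → ℕ → V}
    (h : IsTrunkFamily χ i E y) (hgood : ∀ p, χ p = i % 2 → k < #(goodTrailsAt i y p)) :
    ∃ z, IsTrunkFamily χ i E z ∧ SameEnds i y z ∧ ∀ t, ¬ IsBad i (z t) := by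
  induction hb : #(badTrails i y) using Nat.strong_induction_on generalizing y with
  | _ b ih =>
  by_cases hdone : ∀ t, ¬ IsBad i (y t)
  · exact ⟨y, h, .refl, hdone⟩
  push Not at hdone
  obtain ⟨c, hc⟩ := hdone
  obtain ⟨z, hz, hends, hlt, hge⟩ :=
    h.exists_fewer_bad_of_walk hi (y c (i + 1)) hgood ∅ (notMem_empty c) hc rfl (by simp)
  obtain ⟨w, hw, hends', hw'⟩ :=
    ih _ (hb ▸ hlt) hz (fun p hp => (hgood p hp).trans_le (hge p)) rfl
  exact ⟨w, hw, hends.trans hends', hw'⟩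

open Classical in
/-- If at least `2 * k + 2` trails hang at each vertex of the relevant class, then the trails can be
rearranged, with the same edges and the same ends, so that all of them are paths. -/
theorem IsTrunkFamily.exists_no_bad (hi : i ≤ 2 * k) (h : IsTrunkFamily χ i E y)
    (hhang : ∀ p, χ p = i % 2 → 2 * k + 2 ≤ #{t | y t i = p}) :
    ∃ z, IsTrunkFamily χ i E z ∧ SameEnds i y z ∧ ∀ t, ¬ IsBad i (z t) := by
  obtain ⟨z, hz, hends, hzi, hfew⟩ := h.exists_few_bad hi
  obtain ⟨w, hw, hends', hbad⟩ := hz.exists_no_bad_of_good hi (by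
    intro p hp
    have h₁ := hfew p {t ∈ badTrails i z | z t i = p} (filter_subset _ _) (by simp)
    have h₂ := hhang p hp
    have h₃ : ({t | y t i = p} : Finset ι) ⊆
        goodTrailsAt i z p ∪ {t ∈ badTrails i z | z t i = p} := by
      intro t ht
      simp only [mem_filter, mem_univ, true_and, ← hzi t] at ht
      rw [mem_union, mem_goodTrailsAt, mem_filter, mem_badTrails]
      tauto
    have h₄ := (card_le_card h₃).trans (card_union_le _ _)
    lia)
  exact ⟨w, hw, hends.trans hends', hbad⟩

end Disentangle

/-! ### Growing paths layer by layer -/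

/-- A trail family all of whose members are paths. -/
structure IsPathFamily {V ι : Type*} (χ : V → ℕ) (n : ℕ) (E : Set (Sym2 V))
    (y : ι → ℕ → V) : Prop extends IsTrailFamily χ n E y where
  path_inj : ∀ t r r', r ≤ n → r' ≤ n → y t r = y t r' → r = r'

/-- Every edge of `F` joins the two classes given by `χ`. -/
def IsTwoColored {V : Type*} (χ : V → ℕ) (F : Set (Sym2 V)) : Prop :=
  ∀ e ∈ F, ∃ a b, χ a = 0 ∧ χ b = 1 ∧ e = s(a, b)

section Layers

variable {V ι : Type*} {χ : V → ℕ} {E F : Set (Sym2 V)} {y : ι → ℕ → V}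

theorem IsTwoColored.mono (h : IsTwoColored χ F) (hEF : E ⊆ F) : IsTwoColored χ E :=
  fun e he => h e (hEF he)

theorem IsTwoColored.exists_parity (h : IsTwoColored χ F) (i : ℕ) {e : Sym2 V} (he : e ∈ F) :
    ∃ p w, χ p = i % 2 ∧ χ w = (i + 1) % 2 ∧ e = s(p, w) := by
  obtain ⟨a, b, ha, hb, rfl⟩ := h e he
  rcases Nat.mod_two_eq_zero_or_one i with hi | hi
  · exact ⟨a, b, by lia, by lia, rfl⟩
  · exact ⟨b, a, by lia, by lia, Sym2.eq_swap⟩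

theorem mem_mk_iff_left_eq {p w v : V} (hw : χ v ≠ χ w) :
    v ∈ s(p, w) ↔ p = v := by
  rw [Sym2.mem_iff]
  exact ⟨fun h => (h.resolve_right fun h' => hw (congrArg χ h')).symm, fun h => Or.inl h.symm⟩

theorem edgeDegree_eq_ncard_of_injective {f : ι → Sym2 V} (hf : Function.Injective f)
    (hF : Set.range f = F) (v : V) : edgeDegree F v = {t | v ∈ f t}.ncard := by
  rw [edgeDegree, ← Set.ncard_image_of_injective _ hf]
  congr 1
  ext e
  simp only [← hF, Set.mem_ofPred_eq, Set.mem_image, Set.mem_range]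
  constructor
  · rintro ⟨⟨t, rfl⟩, h⟩; exact ⟨t, h, rfl⟩
  · rintro ⟨t, h, rfl⟩; exact ⟨⟨t, rfl⟩, h⟩

open Classical in
theorem edgeDegree_eq_card_of_injective [Fintype ι] {f : ι → Sym2 V} (hf : Function.Injective f)
    (hF : Set.range f = F) (v : V) : edgeDegree F v = #{t | v ∈ f t} := by
  rw [edgeDegree_eq_ncard_of_injective hf hF, Set.ncard_eq_toFinset_card']
  congr 1
  ext t
  simp

open Classical in
/-- Paths of length `i` can be extended by the edges of `F`, one each, if at each vertex of the
class of their last vertices as many paths end as there are edges of `F`. -/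
theorem IsPathFamily.exists_extension [Finite V] [Fintype ι] {i : ℕ} (h : IsPathFamily χ i E y)
    (hF : IsTwoColored χ F) (hdisj : Disjoint E F)
    (hdeg : ∀ p, χ p = i % 2 → #{t | y t i = p} = edgeDegree F p) :
    ∃ z, IsTrunkFamily χ i (E ∪ F) z ∧ (∀ t, ∀ r ≤ i, z t r = y t r) ∧
      ∀ v, χ v = (i + 1) % 2 → #{t | z t (i + 1) = v} = edgeDegree F v := by
  have : Fintype F := Fintype.ofFinite F
  choose p w hp hw he using fun e : F => hF.exists_parity i e.2
  have hmem_p : ∀ v, χ v = i % 2 → ∀ e : F, v ∈ (e : Sym2 V) ↔ p e = v := by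
    intro v hv e
    rw [he e]
    exact mem_mk_iff_left_eq (χ := χ) (by rw [hw e]; lia)
  have hmem_w : ∀ v, χ v = (i + 1) % 2 → ∀ e : F, v ∈ (e : Sym2 V) ↔ w e = v := by
    intro v hv e
    rw [he e, Sym2.eq_swap]
    exact mem_mk_iff_left_eq (χ := χ) (by rw [hp e]; lia)
  have hfib : ∀ v, Nonempty ({t // y t i = v} ≃ {e // p e = v}) := by
    intro v
    rw [← Fintype.card_eq, Fintype.card_subtype, Fintype.card_subtype]
    by_cases hv : χ v = i % 2
    · rw [hdeg v hv, edgeDegree_eq_card_of_injective Subtype.val_injective Subtype.range_coe]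
      congr 1
      ext e
      simp [hmem_p v hv]
    · rw [filter_false_of_mem (by rintro t - rfl; exact hv (h.color t i le_rfl)),
        filter_false_of_mem (by rintro e - rfl; exact hv (hp e))]
      rfl
  let φ : ι ≃ F := Equiv.ofFiberEquiv fun v => (hfib v).some
  have hφ : ∀ t, p (φ t) = y t i := fun t => Equiv.ofFiberEquiv_map _ t
  let z : ι → ℕ → V := fun t r => if r = i + 1 then w (φ t) else y t r
  have hz : ∀ t, ∀ r ≤ i, z t r = y t r := fun t r hr => by simp [z, show r ≠ i + 1 by lia]
  have hzleaf : ∀ t, z t (i + 1) = w (φ t) := fun t => by simp [z]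
  have hzstep : ∀ t, ∀ r < i, stepEdge (z t) r = stepEdge (y t) r := fun t r hr => by
    rw [stepEdge, hz t r hr.le, hz t _ hr, stepEdge]
  have hzlast : ∀ t, stepEdge (z t) i = φ t := fun t => by
    rw [stepEdge, hz t i le_rfl, hzleaf, he (φ t), hφ]
  have hE : ∀ t, ∀ r < i, stepEdge (y t) r ∈ E := fun t r hr => (h.mem_iff _).mpr ⟨t, r, hr, rfl⟩
  refine ⟨z, ⟨⟨?_, ?_, ?_⟩, ?_⟩, hz, ?_⟩
  · intro t r hr
    rcases Nat.le_succ_iff.mp hr with hr | rfl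
    · rw [hz t r hr]; exact h.color t r hr
    · rw [hzleaf]; exact hw _
  · intro t r t' r' hr hr' hee
    rcases (Nat.lt_succ_iff.mp hr).lt_or_eq with hr | rfl <;>
      rcases (Nat.lt_succ_iff.mp hr').lt_or_eq with hr' | rfl
    · rw [hzstep t r hr, hzstep t' r' hr'] at hee
      exact h.inj _ _ _ _ hr hr' hee
    · rw [hzstep t r hr, hzlast] at hee
      exact (Set.disjoint_left.mp hdisj (hE t r hr) (hee ▸ (φ t').2)).elim
    · rw [hzstep t' r' hr', hzlast] at hee
      exact (Set.disjoint_left.mp hdisj (hE t' r' hr') (hee ▸ (φ t).2)).elim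
    · rw [hzlast, hzlast] at hee
      exact ⟨φ.injective (Subtype.ext hee), rfl⟩
  · intro e
    constructor
    · rintro (hm | hm)
      · obtain ⟨t, r, hr, rfl⟩ := (h.mem_iff e).mp hm
        exact ⟨t, r, by lia, hzstep t r hr⟩
      · exact ⟨φ.symm ⟨e, hm⟩, i, by lia, by rw [hzlast, Equiv.apply_symm_apply]⟩
    · rintro ⟨t, r, hr, rfl⟩
      rcases (Nat.lt_succ_iff.mp hr).lt_or_eq with hr | rfl
      · rw [hzstep t r hr]; exact Or.inl (hE t r hr)
      · rw [hzlast]; exact Or.inr (φ t).2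
  · intro t r r' hr hr' hee
    rw [hz t r hr, hz t r' hr'] at hee
    exact h.path_inj t r r' hr hr' hee
  · intro v hv
    rw [edgeDegree_eq_card_of_injective (f := fun t => (φ t : Sym2 V))
      (Subtype.val_injective.comp φ.injective)
      ((φ.surjective.range_comp Subtype.val).trans Subtype.range_coe)]
    congr 1
    ext t
    simp [hzleaf, hmem_w v hv]

theorem IsTrunkFamily.isPathFamily {i : ℕ} (h : IsTrunkFamily χ i E y)
    (hbad : ∀ t, ¬ IsBad i (y t)) : IsPathFamily χ (i + 1) E y where
  toIsTrailFamily := h.toIsTrailFamily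
  path_inj t r r' hr hr' he := by
    rcases Nat.le_succ_iff.mp hr with hr | rfl <;> rcases Nat.le_succ_iff.mp hr' with hr' | rfl
    · exact h.trunk_inj t r r' hr hr' he
    · exact (hbad t ⟨r, hr, he⟩).elim
    · exact (hbad t ⟨r', hr', he.symm⟩).elim
    · rfl

open Classical in
/-- Let `L 0, …, L (2 * k)` be disjoint sets of edges between the classes of a bipartition such that
each vertex of the class of position `r + 1` has equal degrees, at least `2 * k + 2`, in `L r` and
in `L (r + 1)`. Then the union of these sets decomposes into paths of length `2 * k + 1` whose
numbers of first and last vertices at `v` are the degrees of `v` in `L 0` and in `L (2 * k)`. -/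
theorem exists_pathFamily [Finite V] {k : ℕ} (L : ℕ → Set (Sym2 V)) [Fintype (L 0)]
    (hL : ∀ r ≤ 2 * k, IsTwoColored χ (L r))
    (hdisj : ∀ r ≤ 2 * k, ∀ r' ≤ 2 * k, ∀ e, e ∈ L r → e ∈ L r' → r = r')
    (hdeg : ∀ r < 2 * k, ∀ v, χ v = (r + 1) % 2 → edgeDegree (L r) v = edgeDegree (L (r + 1)) v)
    (hmin : ∀ r < 2 * k, ∀ v, χ v = (r + 1) % 2 → 2 * k + 2 ≤ edgeDegree (L r) v) :
    ∃ y : L 0 → ℕ → V, IsPathFamily χ (2 * k + 1) {e | ∃ r ≤ 2 * k, e ∈ L r} y ∧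
      (∀ v, χ v = 0 → #{t | y t 0 = v} = edgeDegree (L 0) v) ∧
      ∀ v, χ v = 1 → #{t | y t (2 * k + 1) = v} = edgeDegree (L (2 * k)) v := by
  have key : ∀ n ≤ 2 * k + 1, ∃ y : L 0 → ℕ → V, IsPathFamily χ n {e | ∃ r < n, e ∈ L r} y ∧
      (∀ v, χ v = 0 → #{t | y t 0 = v} = edgeDegree (L 0) v) ∧
      (0 < n → ∀ v, χ v = n % 2 → #{t | y t n = v} = edgeDegree (L (n - 1)) v) := by
    intro n
    induction n with
    | zero =>
      intro _
      choose a b ha hb he using fun e : L 0 => hL 0 (Nat.zero_le _) e e.2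
      refine ⟨fun t _ => a t, ⟨⟨?_, ?_, ?_⟩, ?_⟩, ?_, ?_⟩
      · intro t r hr
        rw [ha, Nat.le_zero.mp hr]
      · intro t r t' r' hr
        lia
      · simp
      · intro t r r' hr hr' _
        lia
      · intro v hv
        rw [edgeDegree_eq_card_of_injective Subtype.val_injective Subtype.range_coe]
        congr 1
        ext t
        simp only [mem_filter, mem_univ, true_and]
        exact (he t).symm ▸ (mem_mk_iff_left_eq (χ := χ) (by rw [hb, hv]; exact zero_ne_one)).symm
      · lia
    | succ n ih =>
      intro hn
      obtain ⟨y, hy, hstart, hend⟩ := ih (by lia)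
      have hcount : ∀ p, χ p = n % 2 → #{t | y t n = p} = edgeDegree (L n) p := by
        intro p hp
        rcases n with _ | n
        · exact hstart p hp
        · rw [hend (by lia) p hp, ← hdeg n (by lia) p hp]
          rfl
      obtain ⟨z, hz, hzy, hzleaf⟩ := hy.exists_extension (hL n (by lia))
        (by
          rw [Set.disjoint_left]
          rintro e ⟨r, hr, her⟩ hen
          have := hdisj r (by lia) n (by lia) e her hen
          lia) hcount
      have hE : {e | ∃ r < n, e ∈ L r} ∪ L n = {e | ∃ r < n + 1, e ∈ L r} := by
        ext e
        simp only [Set.mem_union, Set.mem_ofPred_eq]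
        constructor
        · rintro (⟨r, hr, he⟩ | he)
          · exact ⟨r, by lia, he⟩
          · exact ⟨n, by lia, he⟩
        · rintro ⟨r, hr, he⟩
          rcases (Nat.lt_succ_iff.mp hr).lt_or_eq with hr | rfl
          · exact Or.inl ⟨r, hr, he⟩
          · exact Or.inr he
      rw [hE] at hz
      obtain ⟨x, hx, hends, hbad⟩ : ∃ x, IsTrunkFamily χ n {e | ∃ r < n + 1, e ∈ L r} x ∧
          SameEnds n z x ∧ ∀ t, ¬ IsBad n (x t) := by
        rcases n with _ | n
        · refine ⟨z, hz, .refl, ?_⟩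
          rintro t ⟨r, hr, he⟩
          have h₁ := hz.color t r (by lia)
          have h₂ := hz.color t 1 le_rfl
          obtain rfl := Nat.le_zero.mp hr
          rw [he] at h₁
          lia
        · refine hz.exists_no_bad (k := k) (by lia) fun p hp => ?_
          simp only [hzy _ _ le_rfl]
          rw [hcount p hp, ← hdeg n (by lia) p hp]
          exact hmin n (by lia) p hp
      refine ⟨x, hx.isPathFamily hbad, ?_, ?_⟩
      · intro v hv
        rw [← hstart v hv]
        congr 1
        ext t
        rw [mem_filter, mem_filter, hends.1, hzy t 0 (Nat.zero_le _)]
      · intro _ v hv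
        rw [hends.2 v, hzleaf v hv]
        rfl
  obtain ⟨y, hy, hstart, hend⟩ := key (2 * k + 1) le_rfl
  refine ⟨y, ?_, hstart, fun v hv => hend (by lia) v (by lia)⟩
  simpa only [Nat.lt_succ_iff] using hy

end Layers

/-! ### Halving Eulerian edge sets -/

/-- Two fixed-point-free involutions have a common 2-colouring which both of them reverse:
the two involutions swap the orbits of their product in pairs. -/
theorem exists_bool_of_involutive {α : Type*} {a b : α → α} (ha : Function.Involutive a)
    (hb : Function.Involutive b) (ha' : ∀ x, a x ≠ x) (hb' : ∀ x, b x ≠ x) :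
    ∃ f : α → Bool, (∀ x, f (a x) = !f x) ∧ ∀ x, f (b x) = !f x := by
  classical
  let A : Equiv.Perm α := ha.toPerm
  let B : Equiv.Perm α := hb.toPerm
  let ρ : Equiv.Perm α := A * B
  have hAA : A * A = 1 := Equiv.ext ha
  have hBB : B * B = 1 := Equiv.ext hb
  have hconj : A * ρ * A⁻¹ = ρ⁻¹ := by
    rw [eq_inv_iff_mul_eq_one, inv_eq_of_mul_eq_one_left hAA]
    calc A * (A * B) * A * (A * B) = (A * A) * B * (A * A) * B := by simp only [mul_assoc]
      _ = 1 := by rw [hAA, one_mul, mul_one, hBB]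
  have hrefl : ∀ (m : ℤ) x, A ((ρ ^ m) x) = (ρ ^ (-m)) (A x) := by
    intro m x
    have h : A * ρ ^ m * A⁻¹ = ρ ^ (-m) := by rw [← conj_zpow, hconj, inv_zpow, zpow_neg]
    rw [mul_inv_eq_iff_eq_mul] at h
    exact congrArg (fun τ : Equiv.Perm α => τ x) h
  have hne : ∀ x, ¬ ρ.SameCycle x (A x) := by
    rintro x ⟨n, hn⟩
    rcases Int.even_or_odd' n with ⟨m, rfl | rfl⟩
    · refine ha' ((ρ ^ m) x) ?_
      change A ((ρ ^ m) x) = _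
      rw [hrefl, ← hn, ← Equiv.Perm.mul_apply, ← zpow_add]
      congr 2
      lia
    · refine hb' ((ρ ^ m) x) ?_
      change B ((ρ ^ m) x) = _
      apply A.injective
      change (ρ * ρ ^ m) x = _
      rw [hrefl, ← hn, ← Equiv.Perm.mul_apply, ← zpow_add, ← zpow_one_add]
      congr 2
      lia
  let S : Setoid α := Equiv.Perm.SameCycle.setoid ρ
  have hlift : ∀ x y, S x y → S (A x) (A y) := by
    rintro x y ⟨n, hn⟩
    exact ⟨-n, by rw [← hrefl, hn]⟩
  let A' : Quotient S → Quotient S := Quotient.map A hlift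
  have hA' : ∀ q, A' (A' q) = q := by
    intro q
    induction q using Quotient.inductionOn with
    | h x => exact congrArg (Quotient.mk S) (ha x)
  have hA'ne : ∀ q, A' q ≠ q := by
    intro q
    induction q using Quotient.inductionOn with
    | h x => exact fun h => hne x (Equiv.Perm.SameCycle.symm (Quotient.exact h))
  let _ : LinearOrder (Quotient S) := linearOrderOfSTO WellOrderingRel
  let f : α → Bool := fun x => decide ((Quotient.mk S x) < A' (Quotient.mk S x))
  have hfa : ∀ x, f (a x) = !f x := by
    intro x
    have h₁ : Quotient.mk S (a x) = A' (Quotient.mk S x) := rfl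
    simp only [f, h₁, hA']
    rw [← decide_not, decide_eq_decide, not_lt]
    exact ⟨le_of_lt, fun h => lt_of_le_of_ne h (hA'ne _)⟩
  have hfρ : ∀ x, f (ρ x) = f x := by
    intro x
    have h₁ : Quotient.mk S (ρ x) = Quotient.mk S x :=
      Quotient.sound (show ρ.SameCycle (ρ x) x from Equiv.Perm.sameCycle_apply_left.mpr (.refl _ _))
    simp only [f, h₁]
  refine ⟨f, hfa, fun x => ?_⟩
  have h₁ := hfa (b x)
  rw [show f (a (b x)) = f x from hfρ x] at h₁
  rw [h₁, Bool.not_not]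

theorem exists_involutive_of_even_fibers {α β : Type*} [Finite α] (g : α → β)
    (h : ∀ v, Even (Nat.card {x // g x = v})) :
    ∃ a : α → α, Function.Involutive a ∧ (∀ x, a x ≠ x) ∧ ∀ x, g (a x) = g x := by
  have hs : ∀ v, ∃ s : {x // g x = v} → {x // g x = v}, (∀ x, s (s x) = x) ∧ ∀ x, s x ≠ x := by
    intro v
    obtain ⟨m, hm⟩ := h v
    obtain ⟨e⟩ : Nonempty ({x // g x = v} ≃ Fin m × Bool) := by
      rw [← Finite.card_eq, hm]
      simp [mul_two]
    refine ⟨fun x => e.symm ((e x).1, !(e x).2), fun x => by simp, fun x hx => ?_⟩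
    have := congrArg (fun q => (e q).2) hx
    simp at this
  choose s hss hsne using hs
  have hsv : ∀ v x (hx : g x = v), (s (g x) ⟨x, rfl⟩ : α) = s v ⟨x, hx⟩ := by
    rintro v x rfl; rfl
  refine ⟨fun x => s (g x) ⟨x, rfl⟩, fun x => ?_, fun x hx => ?_, fun x => (s (g x) ⟨x, rfl⟩).2⟩
  · dsimp only
    rw [hsv (g x) _ (s (g x) ⟨x, rfl⟩).2]
    exact congrArg Subtype.val (hss (g x) ⟨x, rfl⟩)
  · exact hsne _ _ (Subtype.ext hx)

/-- An Eulerian set of edges of a bipartite graph splits into two halves which have the same degree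
at every vertex. (Of an Eulerian orientation, these are the edges directed to the one class and to
the other.) -/
theorem IsEulerian.exists_half {V : Type*} [Finite V] {χ : V → ℕ} {F : Set (Sym2 V)}
    (hF : IsEulerian F) (hχ : IsTwoColored χ F) :
    ∃ T ⊆ F, ∀ v, edgeDegree T v = edgeDegree (F \ T) v := by
  have hinv : ∀ i, ∃ a : F → F, Function.Involutive a ∧ (∀ e, a e ≠ e) ∧
      ∀ v, χ v = i % 2 → ∀ e : F, v ∈ (e : Sym2 V) → v ∈ (a e : Sym2 V) := by
    intro i
    choose p w hp hw he using fun e : F => hχ.exists_parity i e.2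
    have hmem : ∀ v, χ v = i % 2 → ∀ e : F, v ∈ (e : Sym2 V) ↔ p e = v := by
      intro v hv e
      rw [he e]
      exact mem_mk_iff_left_eq (χ := χ) (by rw [hw e]; lia)
    obtain ⟨a, ha, hane, hap⟩ := exists_involutive_of_even_fibers p (by
      intro v
      by_cases hv : χ v = i % 2
      · have := hF v
        rw [edgeDegree_eq_ncard_of_injective Subtype.val_injective Subtype.range_coe] at this
        rw [← Set.coe_ofPred, Nat.card_coe_set_eq]
        simpa only [hmem v hv] using this
      · have : IsEmpty {e // p e = v} := ⟨fun e => hv (e.2 ▸ hp e.1)⟩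
        simp)
    exact ⟨a, ha, hane, fun v hv e hve => by rw [hmem v hv, hap]; exact (hmem v hv e).mp hve⟩
  obtain ⟨a, ha, hane, hav⟩ := hinv 0
  obtain ⟨b, hb, hbne, hbv⟩ := hinv 1
  obtain ⟨f, hfa, hfb⟩ := exists_bool_of_involutive ha hb hane hbne
  have hdeg : ∀ (c : Bool) v,
      {e | e ∈ Subtype.val '' {e : F | f e = c} ∧ v ∈ e}.ncard =
        {e : F | f e = c ∧ v ∈ (e : Sym2 V)}.ncard := by
    intro c v
    rw [← Set.ncard_image_of_injective _ Subtype.val_injective]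
    congr 1
    ext e
    simp only [Set.mem_image, Set.mem_ofPred_eq]
    constructor
    · rintro ⟨⟨e, he, rfl⟩, hv⟩; exact ⟨e, ⟨he, hv⟩, rfl⟩
    · rintro ⟨e, ⟨he, hv⟩, rfl⟩; exact ⟨⟨e, he, rfl⟩, hv⟩
  have hcompl : F \ Subtype.val '' {e : F | f e = true} = Subtype.val '' {e : F | f e = false} := by
    ext e
    simp only [Set.mem_sdiff, Set.mem_image, Set.mem_ofPred_eq, Subtype.exists, exists_and_right,
      exists_eq_right]
    constructor
    · rintro ⟨he, h⟩
      exact ⟨he, by simpa using fun h' => h ⟨he, h'⟩⟩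
    · rintro ⟨he, h⟩
      exact ⟨he, fun ⟨_, h'⟩ => by simp [h] at h'⟩
  -- the involution that preserves the end `v` exchanges the two halves at `v`
  have hswap : ∀ (c : F → F), Function.Involutive c → (∀ e, f (c e) = !f e) → ∀ v,
      (∀ e : F, v ∈ (e : Sym2 V) → v ∈ (c e : Sym2 V)) →
      {e : F | f e = true ∧ v ∈ (e : Sym2 V)}.ncard =
        {e : F | f e = false ∧ v ∈ (e : Sym2 V)}.ncard := by
    intro c hc hfc v hcv
    rw [← Set.ncard_image_of_injective _ hc.injective]
    congr 1
    ext e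
    simp only [Set.mem_image, Set.mem_ofPred_eq]
    constructor
    · rintro ⟨e, ⟨he, hv⟩, rfl⟩
      exact ⟨by simp [hfc, he], hcv e hv⟩
    · rintro ⟨he, hv⟩
      exact ⟨c e, ⟨by simp [hfc, he], hcv e hv⟩, hc e⟩
  refine ⟨Subtype.val '' {e : F | f e = true}, by simp, fun v => ?_⟩
  rw [hcompl, edgeDegree, edgeDegree, hdeg, hdeg]
  by_cases hv₀ : χ v = 0
  · exact hswap a ha hfa v (hav v (by lia))
  by_cases hv₁ : χ v = 1
  · exact hswap b hb hfb v (hbv v (by lia))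
  have hnot : ∀ e : F, v ∉ (e : Sym2 V) := by
    intro e hve
    obtain ⟨p, w, hp, hw, he⟩ := hχ e e.2
    rw [he, Sym2.mem_iff] at hve
    rcases hve with rfl | rfl <;> contradiction
  simp [hnot]

theorem edgeDegree_union {V : Type*} [Finite V] {E F : Set (Sym2 V)} (h : Disjoint E F) (v : V) :
    edgeDegree (E ∪ F) v = edgeDegree E v + edgeDegree F v := by
  rw [edgeDegree, edgeDegree, edgeDegree, ← Set.ncard_union_eq]
  · congr 1
    ext e
    simp only [Set.mem_union, Set.mem_ofPred_eq]
    tauto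
  · exact h.mono (fun e he => he.1) (fun e he => he.1)

/-! ### The layers of a fractional factorization -/

/-- A fractional factorization with one member `M` and Eulerian members `F j` is refined, by halving
the `F j`, to a sequence of `2 * k + 1` layers: first `M`, and then the two halves of each `F j`. -/
theorem IsFractionalFactorization.exists_layers {V : Type*} [Finite V] {k : ℕ}
    {𝓕 : EdgeFamily V 1 k} {G : SimpleGraph V} {X : Set V} {χ : V → ℕ}
    (h : IsFractionalFactorization G X (2 * k + 1) 𝓕) (hχ : IsTwoColored χ 𝓕.edges) :
    ∃ Q : ℕ → Set (Sym2 V), Q 0 = 𝓕.M 0 ∧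
      (∀ r ≤ 2 * k, ∀ r' ≤ 2 * k, ∀ e, e ∈ Q r → e ∈ Q r' → r = r') ∧
      (∀ e, e ∈ 𝓕.edges ↔ ∃ r ≤ 2 * k, e ∈ Q r) ∧
      (∀ r ≤ 2 * k, ∀ v ∈ X, (2 * k + 1) * edgeDegree (Q r) v = edgeDegree 𝓕.edges v) ∧
      ∀ j < k, ∀ v, edgeDegree (Q (2 * j + 1)) v = edgeDegree (Q (2 * j + 2)) v := by
  have hsub : ∀ i, 𝓕.parts i ⊆ 𝓕.edges := fun i => Set.subset_iUnion 𝓕.parts i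
  have hparts : ∀ i i' e, e ∈ 𝓕.parts i → e ∈ 𝓕.parts i' → i = i' := by
    intro i i' e he he'
    by_contra hne
    exact Set.disjoint_left.mp (h.pairwise_disjoint hne) he he'
  choose T hTF hT using fun j => (h.eulerian_F j).exists_half (hχ.mono (hsub (Sum.inr j)))
  let Q : ℕ → Set (Sym2 V) := fun r =>
    if r = 0 then 𝓕.M 0
    else if hr : (r - 1) / 2 < k then
      if r % 2 = 1 then 𝓕.F ⟨(r - 1) / 2, hr⟩ \ T ⟨(r - 1) / 2, hr⟩ else T ⟨(r - 1) / 2, hr⟩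
    else ∅
  have hQ₀ : Q 0 = 𝓕.M 0 := by simp [Q]
  have hQ₁ : ∀ j : Fin k, Q (2 * j + 1) = 𝓕.F j \ T j := by
    intro j
    have h₁ : (2 * (j : ℕ) + 1 - 1) / 2 = j := by lia
    simp only [Q, Nat.succ_ne_zero, if_false, h₁, j.2, dif_pos, show (2 * (j : ℕ) + 1) % 2 = 1 by lia,
      if_true]
  have hQ₂ : ∀ j : Fin k, Q (2 * j + 2) = T j := by
    intro j
    have h₁ : (2 * (j : ℕ) + 2 - 1) / 2 = j := by lia
    have h₂ : ¬ (2 * (j : ℕ) + 2) % 2 = 1 := by lia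
    simp only [Q, Nat.succ_ne_zero, if_false, h₁, j.2, dif_pos, h₂]
  have hcases : ∀ r ≤ 2 * k, r = 0 ∨ ∃ j : Fin k, r = 2 * j + 1 ∨ r = 2 * j + 2 := by
    intro r hr
    by_cases h₀ : r = 0
    · exact Or.inl h₀
    · exact Or.inr ⟨⟨(r - 1) / 2, by lia⟩, by dsimp only; lia⟩
  have hM : ∀ e ∈ 𝓕.M 0, e ∈ 𝓕.parts (Sum.inl 0) := fun e he => he
  have hF₁ : ∀ j, ∀ e ∈ 𝓕.F j \ T j, e ∈ 𝓕.parts (Sum.inr j) := fun j e he => he.1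
  have hF₂ : ∀ j, ∀ e ∈ T j, e ∈ 𝓕.parts (Sum.inr j) := fun j e he => hTF j he
  refine ⟨Q, hQ₀, ?_, ?_, ?_, ?_⟩
  · intro r hr r' hr' e he he'
    rcases hcases r hr with rfl | ⟨j, rfl | rfl⟩ <;>
      rcases hcases r' hr' with rfl | ⟨j', rfl | rfl⟩ <;>
      simp only [hQ₀, hQ₁, hQ₂] at he he'
    · rfl
    · cases hparts _ _ e (hM e he) (hF₁ j' e he')
    · cases hparts _ _ e (hM e he) (hF₂ j' e he')
    · cases hparts _ _ e (hF₁ j e he) (hM e he')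
    · cases hparts _ _ e (hF₁ j e he) (hF₁ j' e he')
      rfl
    · cases hparts _ _ e (hF₁ j e he) (hF₂ j' e he')
      exact (he.2 he').elim
    · cases hparts _ _ e (hF₂ j e he) (hM e he')
    · cases hparts _ _ e (hF₂ j e he) (hF₁ j' e he')
      exact (he'.2 he).elim
    · cases hparts _ _ e (hF₂ j e he) (hF₂ j' e he')
      rfl
  · intro e
    constructor
    · intro he
      obtain ⟨i, hi⟩ := Set.mem_iUnion.mp he
      rcases i with i | j
      · refine ⟨0, Nat.zero_le _, ?_⟩
        rw [hQ₀]
        rwa [Subsingleton.elim i 0] at hi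
      · by_cases hT' : e ∈ T j
        · exact ⟨2 * j + 2, by lia, by rwa [hQ₂]⟩
        · exact ⟨2 * j + 1, by lia, by rw [hQ₁]; exact ⟨hi, hT'⟩⟩
    · rintro ⟨r, hr, he⟩
      rcases hcases r hr with rfl | ⟨j, rfl | rfl⟩ <;> simp only [hQ₀, hQ₁, hQ₂] at he
      · exact hsub _ (hM e he)
      · exact hsub _ (hF₁ j e he)
      · exact hsub _ (hF₂ j e he)
  · intro r hr v hv
    have hpos : ((2 * k + 1 : ℕ) : ℚ) ≠ 0 := by positivity
    have hhalf : ∀ j, edgeDegree (𝓕.F j) v = 2 * edgeDegree (T j) v := by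
      intro j
      have := edgeDegree_union (Set.disjoint_sdiff_right (s := T j) (t := 𝓕.F j)) v
      rw [Set.union_sdiff_cancel (hTF j), ← hT j v] at this
      lia
    have hTdeg : ∀ j, (2 * k + 1) * edgeDegree (T j) v = edgeDegree 𝓕.edges v := by
      intro j
      have := (h.factor_F j).2 v hv
      rw [hhalf j, ← h.edges_eq] at this
      field_simp at this
      push_cast at this
      rw [← @Nat.cast_inj ℚ]
      push_cast
      linarith
    rcases hcases r hr with rfl | ⟨j, rfl | rfl⟩
    · have := (h.factor_M 0).2 v hv
      rw [← h.edges_eq] at this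
      field_simp at this
      push_cast at this
      rw [hQ₀, ← @Nat.cast_inj ℚ]
      push_cast
      linarith
    · rw [hQ₁, ← hT j v, hTdeg]
    · rw [hQ₂, hTdeg]
  · intro j hj v
    rw [hQ₁ ⟨j, hj⟩, hQ₂ ⟨j, hj⟩, hT]

/-! ### From path families to path tracking decompositions -/

section Trackings

variable {V ι : Type*} {G : SimpleGraph V} {χ : V → ℕ} {n : ℕ} {y : ι → ℕ → V}

theorem exists_walk_of_adj (x : ℕ → V) (n : ℕ) (hx : ∀ r < n, G.Adj (x r) (x (r + 1))) :
    ∃ w : G.Walk (x 0) (x n), w.length = n ∧ w.support = (List.range (n + 1)).map x ∧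
      w.edges = (List.range n).map (stepEdge x) := by
  induction n with
  | zero => exact ⟨.nil, rfl, rfl, rfl⟩
  | succ n ih =>
    obtain ⟨w, hlen, hsupp, hedges⟩ := ih fun r hr => hx r (by lia)
    refine ⟨w.concat (hx n (by lia)), ?_, ?_, ?_⟩
    · rw [SimpleGraph.Walk.length_concat, hlen]
    · rw [SimpleGraph.Walk.support_concat, hsupp, List.range_succ, List.range_succ,
        List.range_succ]
      simp
    · rw [SimpleGraph.Walk.edges_concat, hedges, List.range_succ]
      simp [stepEdge]

theorem Tracking.odd_edgeDegree_iff {B : Tracking G} (hB : B.walk.IsTrail)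
    (hne : B.start ≠ B.finish) (v : V) :
    Odd (edgeDegree B.edgeSet v) ↔ B.start = v ∨ B.finish = v := by
  classical
  have hcount : edgeDegree B.edgeSet v = B.walk.edges.countP (v ∈ ·) := by
    have hset : {e | e ∈ B.edgeSet ∧ v ∈ e} =
        ((B.walk.edges.filter (v ∈ ·)).toFinset : Set (Sym2 V)) := by
      ext e
      simp [Tracking.edgeSet]
    rw [edgeDegree, hset, Set.ncard_coe_finset,
      List.toFinset_card_of_nodup (hB.edges_nodup.filter _), List.countP_eq_length_filter]
  rw [hcount, ← Nat.not_even_iff_odd, hB.even_countP_edges_iff]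
  tauto

open Classical in
theorem IsPathFamily.exists_pathTrackingDecomposition [Fintype ι]
    (h : IsPathFamily χ n G.edgeSet y) (hn : 0 < n) :
    ∃ 𝓑 : Set (Tracking G), IsPathTrackingDecomposition n 𝓑 ∧
      ∀ v, endCount 𝓑 v = #{t | y t 0 = v ∨ y t n = v} := by
  choose w hlen hsupp hedges using fun t => exists_walk_of_adj (G := G) (y t) n
    fun r hr => (h.mem_iff _).mpr ⟨t, r, hr, rfl⟩
  let B : ι → Tracking G := fun t => ⟨y t 0, y t n, w t⟩
  have hmem : ∀ t e, e ∈ (B t).edgeSet ↔ ∃ r < n, stepEdge (y t) r = e := by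
    intro t e
    change e ∈ (w t).edges ↔ _
    rw [hedges]
    simp
  have hpath : ∀ t, (B t).walk.IsPath := by
    intro t
    change (w t).IsPath
    rw [SimpleGraph.Walk.isPath_def, hsupp]
    refine List.Nodup.map_on ?_ List.nodup_range
    intro r hr r' hr' he
    rw [List.mem_range] at hr hr'
    exact h.path_inj t r r' (by lia) (by lia) he
  have hdisj : ∀ t t', t ≠ t' → Disjoint (B t).edgeSet (B t').edgeSet := by
    intro t t' hne
    rw [Set.disjoint_left]
    intro e he he'
    obtain ⟨r, hr, rfl⟩ := (hmem t e).mp he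
    obtain ⟨r', hr', he'⟩ := (hmem t' _).mp he'
    exact hne (h.inj _ _ _ _ hr hr' he'.symm).1
  have hinj : Function.Injective B := by
    intro t t' he
    by_contra hne
    have := hdisj t t' hne
    rw [← he, disjoint_self] at this
    exact (Set.mem_empty_iff_false _).mp (this ▸ (hmem t _).mpr ⟨0, hn, rfl⟩)
  have hends : ∀ t, y t 0 ≠ y t n := fun t he => by
    have := h.path_inj t 0 n (Nat.zero_le n) le_rfl he
    lia
  refine ⟨Set.range B, ⟨⟨?_, ?_, ?_⟩, ?_⟩, ?_⟩
  · rintro _ ⟨t, rfl⟩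
    exact ⟨hlen t, (hpath t).isTrail, (hpath t).tail.dropLast⟩
  · rintro _ ⟨t, rfl⟩ _ ⟨t', rfl⟩ hne
    exact hdisj t t' fun he => hne (congrArg B he)
  · ext e
    simp only [Set.mem_iUnion, Set.exists_range_iff, h.mem_iff, hmem, exists_prop]
  · rintro _ ⟨t, rfl⟩
    exact hpath t
  · intro v
    have hodd : {C | C ∈ Set.range B ∧ Odd (edgeDegree C.edgeSet v)} =
        B '' ({t | y t 0 = v ∨ y t n = v} : Finset ι) := by
      ext C
      constructor
      · rintro ⟨⟨t, rfl⟩, ht⟩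
        exact ⟨t, by simpa using ((B t).odd_edgeDegree_iff (hpath t).isTrail (hends t) v).mp ht, rfl⟩
      · rintro ⟨t, ht, rfl⟩
        exact ⟨⟨t, rfl⟩,
          ((B t).odd_edgeDegree_iff (hpath t).isTrail (hends t) v).mpr (by simpa using ht)⟩
    have heven : {C | C ∈ Set.range B ∧ C.start = v ∧ C.finish = v} = ∅ := by
      ext C
      simp only [Set.mem_ofPred_eq, Set.mem_empty_iff_false, iff_false]
      rintro ⟨⟨t, rfl⟩, h₁, h₂⟩
      exact hends t (h₁.trans h₂.symm)
    rw [endCount, oddCount, evenCount, hodd, heven, Set.ncard_image_of_injective _ hinj,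
      Set.ncard_coe_finset, Set.ncard_empty, mul_zero, add_zero]

end Trackings

end PathDecomp


open PathDecomp in
theorem mainTheorem5 {V : Type*} [Finite V] (G : SimpleGraph V) (A₁ A₂ : Set V)
    (hG : PathDecomp.IsBipartition G A₁ A₂) (k : ℕ) (hk : 0 < k)
    (𝔽 : PathDecomp.BiFamily V 1 k)
    (h𝔽 : PathDecomp.IsStrongBifactorization G A₁ A₂ (2 * k + 1) 𝔽) :
    ∃ 𝓑 : Set (PathDecomp.Tracking G),
      PathDecomp.IsPathTrackingDecomposition (2 * k + 1) 𝓑 ∧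
        PathDecomp.IsBalanced A₁ A₂ 𝔽 𝓑 := by
  classical
  let χ : V → ℕ := fun v => if v ∈ A₁ then 1 else 0
  have hχ₁ : ∀ v, χ v = 1 ↔ v ∈ A₁ := fun v => by simp [χ]
  have hχ₀ : ∀ v, χ v = 0 ↔ v ∈ A₂ := fun v => by
    have h₁ : v ∈ A₁ ∪ A₂ := hG.2 ▸ Set.mem_univ v
    have h₂ : v ∈ A₁ → v ∉ A₂ := fun h => Set.disjoint_left.mp hG.1.disjoint h
    simp only [χ, ite_eq_right_iff, one_ne_zero, imp_false]
    exact ⟨fun h => h₁.resolve_left h, fun h h' => h₂ h' h⟩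
  have hcolor : IsTwoColored χ G.edgeSet := by
    intro e
    induction e with
    | h a b =>
      intro hab
      rcases hG.1.mem_of_adj hab with ⟨ha, hb⟩ | ⟨ha, hb⟩
      · exact ⟨b, a, (hχ₀ b).mpr hb, (hχ₁ a).mpr ha, Sym2.eq_swap⟩
      · exact ⟨a, b, (hχ₀ a).mpr ha, (hχ₁ b).mpr hb, rfl⟩
  have hE₁ : 𝔽.fst.edges = 𝔽.G₁.edgeSet := h𝔽.fst_fact.edges_eq
  have hE₂ : 𝔽.snd.edges = 𝔽.G₂.edgeSet := h𝔽.snd_fact.edges_eq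
  have hE : ∀ e, e ∈ 𝔽.fst.edges → e ∈ 𝔽.snd.edges → False := fun e he₁ he₂ =>
    Set.disjoint_left.mp h𝔽.disjoint (hE₁ ▸ he₁) (hE₂ ▸ he₂)
  obtain ⟨Q₁, hM₁, hQ₁, hmem₁, hdeg₁, hhalf₁⟩ :=
    h𝔽.fst_fact.exists_layers (hcolor.mono h𝔽.fst_subset)
  obtain ⟨Q₂, hM₂, hQ₂, hmem₂, hdeg₂, hhalf₂⟩ :=
    h𝔽.snd_fact.exists_layers (hcolor.mono h𝔽.snd_subset)
  have hconst₁ : ∀ v, χ v = 1 → ∀ r ≤ 2 * k, ∀ r' ≤ 2 * k,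
      edgeDegree (Q₁ r) v = edgeDegree (Q₁ r') v := fun v hv r hr r' hr' =>
    Nat.eq_of_mul_eq_mul_left (Nat.succ_pos _)
      ((hdeg₁ r hr v ((hχ₁ v).mp hv)).trans (hdeg₁ r' hr' v ((hχ₁ v).mp hv)).symm)
  have hconst₂ : ∀ v, χ v = 0 → ∀ r ≤ 2 * k, ∀ r' ≤ 2 * k,
      edgeDegree (Q₂ r) v = edgeDegree (Q₂ r') v := fun v hv r hr r' hr' =>
    Nat.eq_of_mul_eq_mul_left (Nat.succ_pos _)
      ((hdeg₂ r hr v ((hχ₀ v).mp hv)).trans (hdeg₂ r' hr' v ((hχ₀ v).mp hv)).symm)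
  have hmin : ∀ d e : ℕ, (2 * k + 1) * d = e →
      (((2 * k + 1 : ℕ) : ℚ) / (parityParam 1 : ℕ)) *
        (((2 * k + 1 : ℕ) : ℚ) / (parityParam 1 : ℕ) + (parityParam 1 : ℕ)) ≤ (e : ℚ) →
      2 * k + 2 ≤ d := by
    rintro d _ rfl hd
    rw [show parityParam 1 = 1 by simp [parityParam], Nat.cast_one, div_one] at hd
    norm_cast at hd
    exact Nat.le_of_mul_le_mul_left hd (Nat.succ_pos _)
  have hmin₁ : ∀ v, χ v = 1 → ∀ r ≤ 2 * k, 2 * k + 2 ≤ edgeDegree (Q₁ r) v := fun v hv r hr =>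
    hmin _ _ (hdeg₁ r hr v ((hχ₁ v).mp hv)) (h𝔽.fst_strong v ((hχ₁ v).mp hv))
  have hmin₂ : ∀ v, χ v = 0 → ∀ r ≤ 2 * k, 2 * k + 2 ≤ edgeDegree (Q₂ r) v := fun v hv r hr =>
    hmin _ _ (hdeg₂ r hr v ((hχ₀ v).mp hv)) (h𝔽.snd_strong v ((hχ₀ v).mp hv))
  -- the paths are followed from their end in `A₂`; those of the second kind start with the last
  -- layer of the second factorization, so they pass its layers in reversed order
  let L : ℕ → Set (Sym2 V) := fun r => Q₁ r ∪ Q₂ (2 * k - r)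
  have hsub₁ : ∀ r ≤ 2 * k, ∀ e ∈ Q₁ r, e ∈ 𝔽.fst.edges := fun r hr e he =>
    (hmem₁ e).mpr ⟨r, hr, he⟩
  have hsub₂ : ∀ r ≤ 2 * k, ∀ e ∈ Q₂ r, e ∈ 𝔽.snd.edges := fun r hr e he =>
    (hmem₂ e).mpr ⟨r, hr, he⟩
  have hLdeg : ∀ r ≤ 2 * k, ∀ v,
      edgeDegree (L r) v = edgeDegree (Q₁ r) v + edgeDegree (Q₂ (2 * k - r)) v := fun r hr v =>
    edgeDegree_union (Set.disjoint_left.mpr fun e he he' =>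
      hE e (hsub₁ r hr e he) (hsub₂ _ (Nat.sub_le _ _) e he')) v
  have hL : ∀ e, e ∈ G.edgeSet ↔ ∃ r ≤ 2 * k, e ∈ L r := by
    intro e
    rw [← h𝔽.union_eq, ← hE₁, ← hE₂, Set.mem_union, hmem₁, hmem₂]
    constructor
    · rintro (⟨r, hr, he⟩ | ⟨r, hr, he⟩)
      · exact ⟨r, hr, Or.inl he⟩
      · exact ⟨2 * k - r, Nat.sub_le _ _, Or.inr (by rwa [Nat.sub_sub_self hr])⟩
    · rintro ⟨r, hr, he | he⟩
      · exact Or.inl ⟨r, hr, he⟩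
      · exact Or.inr ⟨_, Nat.sub_le _ _, he⟩
  have : Fintype (L 0) := Fintype.ofFinite _
  obtain ⟨y, hy, hstart, hend⟩ := exists_pathFamily (χ := χ) (k := k) L
    (fun r hr => hcolor.mono fun e he => (hL e).mpr ⟨r, hr, he⟩)
    (by
      rintro r hr r' hr' e (he | he) (he' | he')
      · exact hQ₁ r hr r' hr' e he he'
      · exact (hE e (hsub₁ r hr e he) (hsub₂ _ (Nat.sub_le _ _) e he')).elim
      · exact (hE e (hsub₁ r' hr' e he') (hsub₂ _ (Nat.sub_le _ _) e he)).elim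
      · have := hQ₂ _ (Nat.sub_le _ _) _ (Nat.sub_le _ _) e he he'
        lia)
    (by
      intro r hr v hv
      rw [hLdeg r hr.le, hLdeg (r + 1) hr]
      obtain ⟨j, rfl | rfl⟩ := Nat.even_or_odd' r
      · rw [hconst₁ v (by lia) (2 * j) hr.le (2 * j + 1) hr,
          show 2 * k - 2 * j = 2 * (k - j - 1) + 2 by lia,
          show 2 * k - (2 * j + 1) = 2 * (k - j - 1) + 1 by lia, hhalf₂ _ (by lia)]
      · rw [hhalf₁ j (by lia), hconst₂ v (by lia) _ (Nat.sub_le _ _) _ (Nat.sub_le _ _)])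
    (by
      intro r hr v hv
      rw [hLdeg r hr.le]
      rcases Nat.mod_two_eq_zero_or_one (r + 1) with hr' | hr'
      · exact (hmin₂ v (hv.trans hr') _ (Nat.sub_le _ _)).trans (Nat.le_add_left _ _)
      · exact (hmin₁ v (hv.trans hr') r hr.le).trans (Nat.le_add_right _ _))
  rw [← Set.ext (fun e => hL e)] at hy
  obtain ⟨𝓑, h𝓑, hcount⟩ := hy.exists_pathTrackingDecomposition (Nat.succ_pos _)
  have hfirst : ∀ t, χ (y t 0) = 0 := fun t => hy.color t 0 (Nat.zero_le _)
  have hlast : ∀ t, χ (y t (2 * k + 1)) = 1 := fun t => by rw [hy.color t _ le_rfl]; lia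
  have hdiv : ∀ d e : ℕ, (2 * k + 1) * d = e → (d : ℚ) = (e : ℚ) / (2 * (k : ℚ) + 1) := by
    rintro d _ rfl
    have : (2 * (k : ℚ) + 1) ≠ 0 := by positivity
    push_cast
    field_simp
  refine ⟨𝓑, h𝓑, ⟨fun v hv => ?_, fun v hv => ?_⟩⟩
  · have hv₁ := (hχ₁ v).mpr hv
    have h₁ : ∀ t, ¬ y t 0 = v := fun t ht => by have := hfirst t; rw [ht] at this; lia
    simp only [hcount, h₁, false_or]
    rw [hend v hv₁, hLdeg _ le_rfl, Nat.sub_self, hM₂, ← hE₁, Nat.cast_add,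
      hdiv _ _ (hdeg₁ _ le_rfl v hv)]
  · have hv₀ := (hχ₀ v).mpr hv
    have h₁ : ∀ t, ¬ y t (2 * k + 1) = v := fun t ht => by have := hlast t; rw [ht] at this; lia
    simp only [hcount, h₁, or_false]
    rw [hstart v hv₀, hLdeg _ (Nat.zero_le _), Nat.sub_zero, hM₁, ← hE₂, Nat.cast_add,
      hdiv _ _ (hdeg₂ _ le_rfl v hv), add_comm]
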